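/- Let $\varphi(s)=(s-1)\zeta(s)$ for $s\in\mathbb{C}\setminus\{1\}$ and $\varphi(1)=1$, where $\zeta$ is the Riemann zeta function. For an integer $n\ge 0$ let $$\gamma_n=\lim_{m\to\infty}\left[\sum_{k=1}^{m}\frac{(\ln k)^n}{k}-\frac{(\ln m)^{n+1}}{n+1}\right]$$ be the $n$-th Stieltjes constant (with $0^0=1$; part of the claim is that this limit exists). Let $S(k,i)$ be the signed Stirling numbers of the first kind, normalised by $$x(x+1)\cdots(x+k-1)=(-1)^k\sum_{i=0}^{k}(-1)^iS(k,i)\,x^i .$$ For real $\varepsilon>0$ and integers $k\ge 0$ put $$\alpha_k=\sum_{j=0}^{k}(-1)^j\binom{k}{j}\varphi(1+j\varepsilon).$$ Then, for every real $\varepsilon>0$ and every integer $n\ge 0$, the series below converges absolutely and $$\gamma_n=\frac{(-1)^n\,n!}{\varepsilon^{n+1}}\sum_{k=n+1}^{\infty}\frac{(-1)^k}{k!}\,\alpha_k\,S(k,n+1).$$ -/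

import Mathlib

open Filter Topology

/-- The sequence `∑_{k=1}^m (log k)^n / k - (log m)^(n+1) / (n+1)`, with `0 ^ 0 = 1`. -/
noncomputable def stieltjesSeq (n m : ℕ) : ℝ :=
  (∑ k ∈ Finset.Icc 1 m, (Real.log (k : ℝ)) ^ n / (k : ℝ)) -
    (Real.log (m : ℝ)) ^ (n + 1) / ((n : ℝ) + 1)

/-- The `n`-th Stieltjes constant `γ_n`, the limit of `stieltjesSeq n m` as `m → ∞`. -/
noncomputable def stieltjesConst (n : ℕ) : ℝ :=
  limUnder atTop (stieltjesSeq n)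

/-- The entire function `φ(s) = (s - 1) ζ(s)` for `s ≠ 1`, with `φ(1) = 1`. -/
noncomputable def zetaPhi : ℂ → ℂ :=
  Function.update (fun s : ℂ => (s - 1) * riemannZeta s) 1 1

/-- `α_k = ∑_{j=0}^k (-1)^j C(k,j) φ(1 + j ε)`. -/
noncomputable def zetaAlpha (ε : ℝ) (k : ℕ) : ℂ :=
  ∑ j ∈ Finset.range (k + 1),
    (-1 : ℂ) ^ j * (k.choose j : ℂ) * zetaPhi (1 + (j : ℂ) * (ε : ℂ))

/-- The signed Stirling number of the first kind `S(k,i)`. -/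
def signedStirlingFirst (k i : ℕ) : ℤ :=
  (-1) ^ (k + i) * (Nat.stirlingFirst k i : ℤ)

/-- The normalisation of `S(k,i)`:
`x (x+1) ⋯ (x+k-1) = (-1)^k ∑_{i=0}^k (-1)^i S(k,i) x^i`. -/
theorem prod_add_eq_signedStirlingFirst (k : ℕ) (x : ℂ) :
    ∏ i ∈ Finset.range k, (x + (i : ℂ)) =
      (-1 : ℂ) ^ k * ∑ i ∈ Finset.range (k + 1),
        (-1 : ℂ) ^ i * (signedStirlingFirst k i : ℂ) * x ^ i := by
  have key : ∀ k : ℕ, ∏ i ∈ Finset.range k, (x + (i : ℂ)) =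
      ∑ i ∈ Finset.range (k + 1), (Nat.stirlingFirst k i : ℂ) * x ^ i := by
    intro k
    induction k with
    | zero => simp
    | succ k ih =>
      have h0 : (k : ℂ) * (Nat.stirlingFirst k 0 : ℂ) = 0 := by
        cases k <;> simp
      have h1 := Finset.sum_range_succ' (fun i => (Nat.stirlingFirst k i : ℂ) * x ^ i) (k + 1)
      rw [Finset.sum_range_succ, Nat.stirlingFirst_eq_zero_of_lt (Nat.lt_succ_self k)] at h1
      rw [Finset.prod_range_succ, ih,
        Finset.sum_range_succ' (fun i => (Nat.stirlingFirst (k + 1) i : ℂ) * x ^ i) (k + 1)]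
      simp only [Nat.stirlingFirst_succ_succ, Nat.stirlingFirst_succ_zero, Nat.cast_add,
        Nat.cast_mul, add_mul, Finset.sum_add_distrib, Nat.cast_zero, zero_mul, add_zero]
      have h2 : ∑ i ∈ Finset.range (k + 1), (Nat.stirlingFirst k i : ℂ) * x ^ (i + 1) =
          (∑ i ∈ Finset.range (k + 1), (Nat.stirlingFirst k i : ℂ) * x ^ i) * x := by
        rw [Finset.sum_mul]
        exact Finset.sum_congr rfl fun i _ => by ring
      have h3 : ∑ i ∈ Finset.range (k + 1),
          (k : ℂ) * (Nat.stirlingFirst k (i + 1) : ℂ) * x ^ (i + 1) =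
          (k : ℂ) * ∑ i ∈ Finset.range (k + 1),
            (Nat.stirlingFirst k (i + 1) : ℂ) * x ^ (i + 1) := by
        rw [Finset.mul_sum]
        exact Finset.sum_congr rfl fun i _ => by ring
      rw [h2, h3]
      simp only [Nat.cast_zero, zero_mul, add_zero, pow_zero, mul_one] at h1
      linear_combination (k : ℂ) * h1 + h0
  rw [key, Finset.mul_sum]
  refine Finset.sum_congr rfl fun i _ => ?_
  have e : ((-1 : ℂ) ^ k * (-1) ^ i) * ((-1) ^ k * (-1) ^ i) = 1 := by
    rw [← pow_add, ← pow_add]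
    exact Even.neg_one_pow ⟨k + i, rfl⟩
  simp only [signedStirlingFirst]
  push_cast
  rw [pow_add]
  linear_combination (-(Nat.stirlingFirst k i : ℂ) * x ^ i) * e

/-!
Newton interpolation of `x ↦ φ(1 + εx)` at the nonnegative integers reads
`φ(1 + εx) = ∑ (-1)^k α_k x(x-1)⋯(x-k+1) / k!`, and the claim compares the coefficients of
`x^(n+1)`.
It is proved here without complex analysis of `φ`, by an integral representation.

Euler–Maclaurin summation gives, for `t ≥ 0`,
`φ(1 + t) = 1 + t - (1 + t) t ∫_1^∞ {x} x^(-2) x^(-t) dx` (`zetaPhi_one_add_ofReal`) and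
`γ_n = [n = 0] + ∫_1^∞ {x} x^(-2) (n (log x)^(n-1) - (log x)^n) dx` (`tendsto_stieltjesSeq`).
With `t = jε` and `y = x^(-ε)` the alternating binomial sum `α_k` can be evaluated under the
integral sign (`zetaAlpha_eq`): the linear part `1 + t` matters only for `k = 0, 1`, and the
integrand becomes a combination of `k y (1-y)^(k-1)` and `k(k-1) y² (1-y)^(k-2)`.

Up to the constant sign `(-1)^(n+1)`, the coefficient `(-1)^k S(k,n+1) / k!` is the Taylor
coefficient `c(k,n+1) / k!` of `G(u) = (-log(1-u))^(n+1) / (n+1)!`. Summing over `k` therefore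
produces `y G'(1-y)` and `y² G''(1-y)`, which are polynomials in `-log y = ε log x`. All terms of
these two series are nonnegative, so each series dominates its own partial sums and may be
integrated termwise (`hasSum_integral_alphaKernel`). The resulting integral is the
one representing `γ_n`, up to the factor `ε^(n+1) / n!`; the linear part `1 + t` of `φ` accounts for
the term `[n = 0]`.
-/

open MeasureTheory Set

/-! ### Euler–Maclaurin summation for `γ_n` and `φ` -/

/-- First-order Euler–Maclaurin summation, with remainder in terms of the fractional part. Applied
to `(log x) ^ n / x` it gives the Stieltjes constants, applied to `x ^ (-s)` the zeta function. -/
theorem sum_Icc_eq_add_integral_fract_mul {f f' F : ℝ → ℝ}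
    (hF : ∀ x, 1 ≤ x → HasDerivAt F (f x) x) (hf : ∀ x, 1 ≤ x → HasDerivAt f (f' x) x)
    (hf' : ContinuousOn f' (Ici 1)) (m : ℕ) (hm : 1 ≤ m) :
    ∑ k ∈ Finset.Icc 1 m, f k = f 1 + (F m - F 1) + ∫ x in (1 : ℝ)..m, Int.fract x * f' x := by
  have hfract : ∀ k : ℕ, 1 ≤ k →
      EqOn (fun x : ℝ => Int.fract x * f' x) (fun x => (x - k) * f' x) (Ioo (k : ℝ) (k + 1)) := by
    intro k _ x hx
    have : ⌊x⌋ = (k : ℤ) := Int.floor_eq_iff.2 ⟨by simpa using hx.1.le, by simpa using hx.2⟩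
    simp [Int.fract, this]
  have hint : ∀ k : ℕ, 1 ≤ k →
      IntervalIntegrable f' volume k (k + 1) := by
    intro k hk
    refine (hf'.mono fun x hx => ?_).intervalIntegrable
    rw [uIcc_of_le (by linarith)] at hx
    exact le_trans (by exact_mod_cast hk) hx.1
  have hint2 : ∀ k : ℕ, 1 ≤ k →
      IntervalIntegrable (fun x : ℝ => Int.fract x * f' x) volume k (k + 1) := by
    intro k hk
    have h : IntervalIntegrable (fun x : ℝ => (x - k) * f' x) volume k (k + 1) :=
      (hint k hk).continuousOn_mul (by fun_prop)
    refine h.congr_uIoo ?_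
    rw [uIoo_of_le (by linarith)]
    exact (hfract k hk).symm
  have hstep : ∀ k : ℕ, 1 ≤ k →
      ∫ x in (k : ℝ)..(k + 1), Int.fract x * f' x = f (k + 1) - (F (k + 1) - F k) := by
    intro k hk
    have hk1 : (1 : ℝ) ≤ k := by exact_mod_cast hk
    have hge : ∀ x ∈ uIcc (k : ℝ) (k + 1), 1 ≤ x := by
      intro x hx
      rw [uIcc_of_le (by linarith)] at hx
      exact hk1.trans hx.1
    -- On `[k, k + 1]` the fractional part is `x - k`: integrate by parts.
    have hfi : IntervalIntegrable f volume k (k + 1) :=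
      ContinuousOn.intervalIntegrable fun x hx =>
        (hf x (hge x hx)).continuousAt.continuousWithinAt
    rw [intervalIntegral.integral_congr_uIoo (g := fun x => (x - k) * f' x)
      (by rw [uIoo_of_le (by linarith)]; exact hfract k hk),
      intervalIntegral.integral_mul_deriv_eq_deriv_mul (u := fun x => x - (k : ℝ))
        (u' := fun _ => 1) (v := f) (fun x _ => (hasDerivAt_id x).sub_const _)
        (fun x hx => hf x (hge x hx)) (by simp) (hint k hk)]
    simp only [one_mul]
    rw [intervalIntegral.integral_eq_sub_of_hasDerivAt (fun x hx => hF x (hge x hx)) hfi]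
    simp
  induction m, hm using Nat.le_induction with
  | base => simp
  | succ m hm ih =>
    have h1m : IntervalIntegrable (fun x : ℝ => Int.fract x * f' x) volume 1 m := by
      have := IntervalIntegrable.trans_iterate_Ico (f := fun x : ℝ => Int.fract x * f' x)
        (μ := volume) (a := fun k : ℕ => (k : ℝ)) hm
        (fun k hk => by simpa using hint2 k hk.1)
      simpa using this
    have hadd := intervalIntegral.integral_add_adjacent_intervals h1m (hint2 m hm)
    rw [Finset.sum_Icc_succ_top (by omega), ih]
    push_cast
    rw [← hadd, hstep m hm]
    ring

theorem integrableOn_fract_mul_log_pow (j : ℕ) :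
    IntegrableOn (fun x : ℝ => Int.fract x / x ^ 2 * Real.log x ^ j) (Ioi 1) := by
  -- With this `δ`, `log x ≤ x ^ δ / δ` gives `(log x) ^ j = O(x ^ (1 / 2))`.
  have hδ : (0 : ℝ) < 1 / (2 * (j + 1)) := by positivity
  set δ : ℝ := 1 / (2 * (j + 1)) with hδ'
  have hmeas : Measurable (fun x : ℝ => Int.fract x / x ^ 2 * Real.log x ^ j) := by
    have := measurable_fract (R := ℝ)
    fun_prop
  refine Integrable.mono' (((integrableOn_Ioi_rpow_of_lt (a := -(3 / 2)) (by norm_num)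
    one_pos)).const_mul ((1 / δ) ^ j)) hmeas.aestronglyMeasurable ?_
  refine (ae_restrict_iff' measurableSet_Ioi).2 (ae_of_all _ fun x hx => ?_)
  have hx1 : 1 < x := hx
  have hx0 : 0 < x := by linarith
  have hl : 0 ≤ Real.log x := Real.log_nonneg hx1.le
  have hδj : δ * j ≤ 1 / 2 := by
    rw [hδ', div_mul_eq_mul_div, div_le_iff₀ (by positivity)]
    linarith
  have hpow : Real.log x ^ j ≤ (1 / δ) ^ j * x ^ (1 / 2 : ℝ) := by
    calc Real.log x ^ j ≤ (x ^ δ / δ) ^ j := by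
          gcongr
          exact Real.log_le_rpow_div hx0.le hδ
      _ = (1 / δ) ^ j * x ^ (δ * j) := by
          rw [Real.rpow_mul hx0.le, Real.rpow_natCast, div_pow, one_div_pow]; ring
      _ ≤ _ := by gcongr; exact hx1.le
  have hw : Int.fract x / x ^ 2 ≤ x ^ (-2 : ℝ) := by
    rw [Real.rpow_neg hx0.le, Real.rpow_two, div_eq_mul_inv]
    exact mul_le_of_le_one_left (by positivity) (Int.fract_lt_one x).le
  have hw0 : 0 ≤ Int.fract x / x ^ 2 := div_nonneg (Int.fract_nonneg x) (by positivity)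
  rw [Real.norm_of_nonneg (by positivity)]
  calc _ ≤ x ^ (-2 : ℝ) * ((1 / δ) ^ j * x ^ (1 / 2 : ℝ)) := by gcongr
    _ = (1 / δ) ^ j * (x ^ (-2 : ℝ) * x ^ (1 / 2 : ℝ)) := by ring
    _ = _ := by rw [← Real.rpow_add hx0]; norm_num

/-- The limit defining `γ_n` exists, and
`γ_n = [n = 0] + ∫_1^∞ {x} (n (log x)^(n-1) - (log x)^n) / x² dx`.
The truncated exponent `n - 1` at `n = 0` is harmless because of the factor `n`. -/
theorem tendsto_stieltjesSeq (n : ℕ) :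
    Tendsto (stieltjesSeq n) atTop (𝓝 ((if n = 0 then 1 else 0) +
      ∫ x in Ioi (1 : ℝ),
        Int.fract x / x ^ 2 * (n * Real.log x ^ (n - 1) - Real.log x ^ n))) := by
  have hint : IntegrableOn (fun x : ℝ =>
      Int.fract x / x ^ 2 * (n * Real.log x ^ (n - 1) - Real.log x ^ n)) (Ioi 1) := by
    refine (((integrableOn_fract_mul_log_pow (n - 1)).const_mul (n : ℝ)).sub
      (integrableOn_fract_mul_log_pow n)).congr (ae_of_all _ fun x => ?_)
    simp only [Pi.sub_apply]
    ring
  refine ((intervalIntegral_tendsto_integral_Ioi 1 hint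
    tendsto_natCast_atTop_atTop).const_add _).congr' ?_
  filter_upwards [eventually_ge_atTop 1] with m hm
  have key := sum_Icc_eq_add_integral_fract_mul (f := fun x => Real.log x ^ n / x)
    (F := fun x => Real.log x ^ (n + 1) / ((n : ℝ) + 1))
    (f' := fun x => (n * Real.log x ^ (n - 1) - Real.log x ^ n) / x ^ 2) ?_ ?_ ?_ m hm
  · rw [stieltjesSeq, key]
    have : ∀ x : ℝ, Int.fract x / x ^ 2 * (n * Real.log x ^ (n - 1) - Real.log x ^ n) =
      Int.fract x * ((n * Real.log x ^ (n - 1) - Real.log x ^ n) / x ^ 2) := fun x => by ring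
    simp only [this, Real.log_one]
    rcases n with _ | n <;> simp
    all_goals ring
  · intro x hx
    have hx0 : x ≠ 0 := by linarith
    have := ((Real.hasDerivAt_log hx0).pow (n + 1)).div_const ((n : ℝ) + 1)
    refine HasDerivAt.congr_deriv this ?_
    have : (n : ℝ) + 1 ≠ 0 := by positivity
    push_cast
    field_simp
  · intro x hx
    have hx0 : x ≠ 0 := by linarith
    have := ((Real.hasDerivAt_log hx0).pow n).div (hasDerivAt_id x) hx0
    refine HasDerivAt.congr_deriv this ?_
    simp only [id, Pi.pow_apply]
    field_simp
  · have hlog : ContinuousOn Real.log (Ici 1) :=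
      Real.continuousOn_log.mono fun x (hx : 1 ≤ x) => by
        simp only [mem_compl_iff, mem_singleton_iff]; linarith
    refine ContinuousOn.div (by fun_prop) (by fun_prop) fun x (hx : 1 ≤ x) => by positivity

theorem integrableOn_fract_mul_rpow_neg {t : ℝ} (ht : 0 ≤ t) :
    IntegrableOn (fun x : ℝ => Int.fract x / x ^ 2 * x ^ (-t)) (Ioi 1) := by
  have h0 := integrableOn_fract_mul_log_pow 0
  simp only [pow_zero, mul_one] at h0
  have hmeas : Measurable (fun x : ℝ => Int.fract x / x ^ 2 * x ^ (-t)) := by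
    have := measurable_fract (R := ℝ)
    fun_prop
  refine Integrable.mono' h0 hmeas.aestronglyMeasurable ?_
  refine (ae_restrict_iff' measurableSet_Ioi).2 (ae_of_all _ fun x hx => ?_)
  have hx1 : 1 < x := hx
  have hw0 : 0 ≤ Int.fract x / x ^ 2 := div_nonneg (Int.fract_nonneg x) (by positivity)
  rw [Real.norm_of_nonneg (by positivity)]
  exact mul_le_of_le_one_right hw0 (Real.rpow_le_one_of_one_le_of_nonpos hx1.le (by linarith))

/-- On `[1, ∞)` the function `φ` is a polynomial combination of `1` and an integral of `x ^ (-t)`: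
`φ(1 + t) = 1 + t - (1 + t) t ∫_1^∞ {x} x^(-2-t) dx`. The case `t = 0` is the value `φ(1) = 1`. -/
theorem zetaPhi_one_add_ofReal {t : ℝ} (ht : 0 ≤ t) :
    zetaPhi (1 + (t : ℂ)) =
      ((1 + t - (1 + t) * t * ∫ x in Ioi (1 : ℝ), Int.fract x / x ^ 2 * x ^ (-t) : ℝ) : ℂ) := by
  rcases ht.eq_or_lt with rfl | ht
  · simp [zetaPhi]
  have hne : (1 + (t : ℂ)) ≠ 1 := by simpa using ht.ne'
  -- The partial sums of `∑ k ^ (-(1 + t))` have two expressions for their limit: `ζ(1 + t)`, and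
  -- the one that Euler–Maclaurin summation gives.
  have hsum : Tendsto (fun m : ℕ => ∑ k ∈ Finset.Icc 1 m, (k : ℝ) ^ (-(1 + t))) atTop
      (𝓝 (∑' k : ℕ, 1 / ((k : ℝ) + 1) ^ (1 + t))) := by
    have hs : Summable (fun k : ℕ => 1 / ((k : ℝ) + 1) ^ (1 + t)) := by
      have := (summable_nat_add_iff 1).2
        (Real.summable_one_div_nat_rpow.2 (by linarith : 1 < 1 + t))
      simpa using this
    refine hs.hasSum.tendsto_sum_nat.congr fun m => ?_
    rw [← Finset.Ico_add_one_right_eq_Icc, Finset.sum_Ico_eq_sum_range, Nat.add_sub_cancel]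
    refine Finset.sum_congr rfl fun k _ => ?_
    rw [Real.rpow_neg (by positivity), one_div]
    push_cast
    rw [add_comm]
  have hlim : Tendsto (fun m : ℕ => ∑ k ∈ Finset.Icc 1 m, (k : ℝ) ^ (-(1 + t))) atTop
      (𝓝 (1 + (0 - (-(1 / t))) +
        ∫ x in Ioi (1 : ℝ), -(1 + t) * (Int.fract x / x ^ 2 * x ^ (-t)))) := by
    have hF : Tendsto (fun m : ℕ => -((m : ℝ) ^ (-t) / t)) atTop (𝓝 0) := by
      simpa using (((tendsto_rpow_neg_atTop ht).comp tendsto_natCast_atTop_atTop).div_const t).neg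
    refine ((tendsto_const_nhds.add (hF.sub tendsto_const_nhds)).add
      (intervalIntegral_tendsto_integral_Ioi 1
        ((integrableOn_fract_mul_rpow_neg ht.le).const_mul _)
        tendsto_natCast_atTop_atTop)).congr' ?_
    · filter_upwards [eventually_ge_atTop 1] with m hm
      rw [sum_Icc_eq_add_integral_fract_mul (f := fun x => x ^ (-(1 + t)))
        (F := fun x => -(x ^ (-t) / t)) (f' := fun x => -(1 + t) * x ^ (-(1 + t) - 1))
        ?_ ?_ ?_ m hm]
      · simp only [Real.one_rpow]
        congr 1
        refine intervalIntegral.integral_congr fun x hx => ?_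
        rw [uIcc_of_le (by exact_mod_cast hm)] at hx
        have hx0 : 0 < x := by linarith [hx.1]
        rw [show -(1 + t) - 1 = -t - (2 : ℕ) by push_cast; ring, Real.rpow_sub_natCast hx0.ne']
        ring
      · intro x hx
        have := ((Real.hasDerivAt_rpow_const (p := -t)
          (Or.inl (by linarith : x ≠ 0))).div_const t).neg
        refine HasDerivAt.congr_deriv this ?_
        rw [show -t - 1 = -(1 + t) by ring]
        field_simp
      · intro x hx
        exact Real.hasDerivAt_rpow_const (Or.inl (by linarith : x ≠ 0))
      · refine ContinuousOn.mul continuousOn_const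
          (continuousOn_id.rpow_const fun x (hx : 1 ≤ x) => Or.inl ?_)
        simp only [id]; linarith
  have heq := tendsto_nhds_unique hsum hlim
  have hz : riemannZeta (1 + (t : ℂ)) = ((∑' k : ℕ, 1 / ((k : ℝ) + 1) ^ (1 + t) : ℝ) : ℂ) := by
    rw [zeta_eq_tsum_one_div_nat_add_one_cpow (by simpa using ht), Complex.ofReal_tsum]
    congr 1 with k
    have := Complex.ofReal_cpow (by positivity : (0 : ℝ) ≤ (k : ℝ) + 1) (1 + t)
    push_cast at this ⊢
    rw [this]
  rw [zetaPhi, Function.update_of_ne hne, hz, heq, integral_const_mul]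
  push_cast
  have : (t : ℂ) ≠ 0 := by exact_mod_cast ht.ne'
  field_simp
  ring

/-! ### Generating functions of the Stirling numbers of the first kind -/

/-- The function `(-log (1 - u)) ^ m / m!`, whose Taylor series at `0` is the exponential generating
function `∑_k c(k,m) u^k / k!` of the unsigned Stirling numbers of the first kind. -/
noncomputable def stirlingEGF (m : ℕ) (u : ℂ) : ℂ :=
  (-Complex.log (1 - u)) ^ m / m.factorial

theorem stirlingEGF_zero : stirlingEGF 0 = fun _ => 1 := by
  ext; simp [stirlingEGF]

theorem one_sub_mem_slitPlane {u : ℂ} (hu : u ∈ Metric.ball (0 : ℂ) 1) :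
    1 - u ∈ Complex.slitPlane := by
  refine Or.inl ?_
  have h1 := Complex.re_le_norm u
  have h2 : ‖u‖ < 1 := by simpa using hu
  simp only [Complex.sub_re, Complex.one_re]
  linarith

theorem hasDerivAt_stirlingEGF_succ (m : ℕ) {u : ℂ} (hu : u ∈ Metric.ball (0 : ℂ) 1) :
    HasDerivAt (stirlingEGF (m + 1)) (stirlingEGF m u / (1 - u)) u := by
  have hs := one_sub_mem_slitPlane hu
  have h0 := Complex.slitPlane_ne_zero hs
  have h := ((((hasDerivAt_id u).const_sub 1).clog hs).neg.pow (m + 1)).div_const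
    (((m + 1).factorial : ℕ) : ℂ)
  refine HasDerivAt.congr_deriv h ?_
  have h1 : ((m : ℂ) + 1) ≠ 0 := by exact_mod_cast Nat.succ_ne_zero m
  have h2 : (m.factorial : ℂ) ≠ 0 := by exact_mod_cast m.factorial_ne_zero
  simp only [stirlingEGF, Nat.factorial_succ, id, Pi.neg_apply]
  push_cast
  field_simp

theorem differentiableOn_stirlingEGF (m : ℕ) :
    DifferentiableOn ℂ (stirlingEGF m) (Metric.ball 0 1) := by
  cases m with
  | zero =>
    rw [stirlingEGF_zero]; fun_prop
  | succ m => exact fun u hu =>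
      (hasDerivAt_stirlingEGF_succ m hu).differentiableAt.differentiableWithinAt

theorem differentiableOn_iteratedDeriv_stirlingEGF (m k : ℕ) :
    DifferentiableOn ℂ (iteratedDeriv k (stirlingEGF m)) (Metric.ball 0 1) := by
  rw [iteratedDeriv_eq_iterate]
  exact (((differentiableOn_stirlingEGF m).analyticOnNhd
    Metric.isOpen_ball).iterated_deriv k).differentiableOn

/-- The `k`-th derivative of `(1 - u) G'_{m+1} = G_m`. At `u = 0` it is the recurrence
`c(k+1,m+1) = k c(k,m+1) + c(k,m)`. -/
theorem one_sub_mul_iteratedDeriv_stirlingEGF (m k : ℕ) {u : ℂ}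
    (hu : u ∈ Metric.ball (0 : ℂ) 1) :
    (1 - u) * iteratedDeriv (k + 1) (stirlingEGF (m + 1)) u =
      k * iteratedDeriv k (stirlingEGF (m + 1)) u + iteratedDeriv k (stirlingEGF m) u := by
  induction k generalizing u with
  | zero =>
    have h0 := Complex.slitPlane_ne_zero (one_sub_mem_slitPlane hu)
    rw [iteratedDeriv_one, (hasDerivAt_stirlingEGF_succ m hu).deriv]
    simp only [iteratedDeriv_zero]
    field_simp
    simp
  | succ k ih =>
    have hd : ∀ m k, HasDerivAt (iteratedDeriv k (stirlingEGF m))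
        (iteratedDeriv (k + 1) (stirlingEGF m) u) u := by
      intro m k
      rw [iteratedDeriv_succ]
      exact ((differentiableOn_iteratedDeriv_stirlingEGF m k).differentiableAt
        (Metric.isOpen_ball.mem_nhds hu)).hasDerivAt
    have hev : (fun v => (1 - v) * iteratedDeriv (k + 1) (stirlingEGF (m + 1)) v) =ᶠ[𝓝 u]
        fun v => k * iteratedDeriv k (stirlingEGF (m + 1)) v + iteratedDeriv k (stirlingEGF m) v :=
      (Metric.isOpen_ball.eventually_mem hu).mono fun v hv => ih hv
    have hl := ((hasDerivAt_id u).const_sub 1).mul (hd (m + 1) (k + 1))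
    have hr := ((hd (m + 1) k).const_mul (k : ℂ)).add (hd m k)
    have := hl.unique (hr.congr_of_eventuallyEq hev)
    simp only [id] at this
    push_cast
    linear_combination this

theorem iteratedDeriv_stirlingEGF_zero (m k : ℕ) :
    iteratedDeriv k (stirlingEGF m) 0 = (Nat.stirlingFirst k m : ℂ) := by
  induction k generalizing m with
  | zero => cases m <;> simp [stirlingEGF]
  | succ k ih =>
    cases m with
    | zero =>
      simp [stirlingEGF_zero, iteratedDeriv_const]
    | succ m =>
      have := one_sub_mul_iteratedDeriv_stirlingEGF m k (u := 0) (by simp)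
      rw [ih, ih] at this
      rw [Nat.stirlingFirst_succ_succ]
      push_cast
      simpa using this

/-- The terms are casts of real numbers, so that the sums at real points can be read off in `ℝ`. -/
theorem hasSum_stirlingFirst_iteratedDeriv (m i : ℕ) {u : ℝ}
    (hu : (u : ℂ) ∈ Metric.ball (0 : ℂ) 1) :
    HasSum (fun k : ℕ => ((Nat.stirlingFirst (k + i) m / k.factorial * u ^ k : ℝ) : ℂ))
      (iteratedDeriv i (stirlingEGF m) u) := by
  have h := Complex.hasSum_taylorSeries_on_ball
    (differentiableOn_iteratedDeriv_stirlingEGF m i) hu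
  refine h.congr_fun fun k => ?_
  have : iteratedDeriv k (iteratedDeriv i (stirlingEGF m)) =
      iteratedDeriv (k + i) (stirlingEGF m) := by
    simp only [iteratedDeriv_eq_iterate, Function.iterate_add_apply]
  rw [this, iteratedDeriv_stirlingEGF_zero]
  push_cast
  simp only [smul_eq_mul, sub_zero]
  ring

theorem hasSum_stirlingFirst_succ (n : ℕ) {y : ℝ} (hy : 0 < y) (hy1 : y < 1) :
    HasSum (fun k : ℕ => (Nat.stirlingFirst (k + 1) (n + 1) : ℝ) / k.factorial * (1 - y) ^ k)
      ((-Real.log y) ^ n / n.factorial / y) := by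
  have hu : ((1 - y : ℝ) : ℂ) ∈ Metric.ball (0 : ℂ) 1 := by
    rw [mem_ball_zero_iff, Complex.norm_real, Real.norm_of_nonneg (by linarith)]; linarith
  have h := hasSum_stirlingFirst_iteratedDeriv (n + 1) 1 hu
  have e := one_sub_mul_iteratedDeriv_stirlingEGF n 0 hu
  have hy0 : (y : ℂ) ≠ 0 := by exact_mod_cast hy.ne'
  have e2 : iteratedDeriv 1 (stirlingEGF (n + 1)) ((1 - y : ℝ) : ℂ) =
      (((-Real.log y) ^ n / n.factorial / y : ℝ) : ℂ) := by
    rw [eq_comm]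
    push_cast at e ⊢
    simp only [sub_sub_cancel, zero_mul, zero_add, iteratedDeriv_zero, stirlingEGF] at e
    rw [Complex.ofReal_log hy.le, div_eq_iff hy0]
    linear_combination -e
  rw [e2] at h
  exact Complex.hasSum_ofReal.1 h

theorem hasSum_stirlingFirst_add_two (n : ℕ) {y : ℝ} (hy : 0 < y) (hy1 : y < 1) :
    HasSum (fun k : ℕ => (Nat.stirlingFirst (k + 2) (n + 1) : ℝ) / k.factorial * (1 - y) ^ k)
      (((-Real.log y) ^ n + n * (-Real.log y) ^ (n - 1)) / n.factorial / y ^ 2) := by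
  have hu : ((1 - y : ℝ) : ℂ) ∈ Metric.ball (0 : ℂ) 1 := by
    rw [mem_ball_zero_iff, Complex.norm_real, Real.norm_of_nonneg (by linarith)]; linarith
  have h := hasSum_stirlingFirst_iteratedDeriv (n + 1) 2 hu
  have e := one_sub_mul_iteratedDeriv_stirlingEGF n 1 hu
  have hd : ∀ m : ℕ, iteratedDeriv 1 (stirlingEGF (m + 1)) ((1 - y : ℝ) : ℂ) =
      (((-Real.log y) ^ m / m.factorial / y : ℝ) : ℂ) := fun m =>
    (hasSum_stirlingFirst_iteratedDeriv (m + 1) 1 hu).unique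
      (Complex.hasSum_ofReal.2 (hasSum_stirlingFirst_succ m hy hy1))
  have hy0 : (y : ℂ) ≠ 0 := by exact_mod_cast hy.ne'
  have hd' : iteratedDeriv 1 (stirlingEGF n) ((1 - y : ℝ) : ℂ) =
      ((n * (-Real.log y) ^ (n - 1) / n.factorial / y : ℝ) : ℂ) := by
    cases n with
    | zero =>
      simp [stirlingEGF_zero, iteratedDeriv_const]
    | succ n =>
      rw [hd]
      have h1 : ((n : ℝ) + 1) ≠ 0 := by positivity
      congr 1
      rw [Nat.factorial_succ, Nat.add_sub_cancel]
      push_cast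
      field_simp
  rw [hd, hd'] at e
  have e2 : iteratedDeriv 2 (stirlingEGF (n + 1)) ((1 - y : ℝ) : ℂ) =
      ((((-Real.log y) ^ n + n * (-Real.log y) ^ (n - 1)) / n.factorial / y ^ 2 : ℝ) : ℂ) := by
    have : (y : ℂ) * iteratedDeriv 2 (stirlingEGF (n + 1)) ((1 - y : ℝ) : ℂ) = y *
      ((((-Real.log y) ^ n + n * (-Real.log y) ^ (n - 1)) / n.factorial / y ^ 2 : ℝ) : ℂ) := by
      have h3 : (1 : ℂ) - ((1 - y : ℝ) : ℂ) = y := by push_cast; ring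
      rw [h3] at e
      rw [e]
      push_cast
      field_simp
    exact mul_left_cancel₀ hy0 this
  rw [e2] at h
  exact Complex.hasSum_ofReal.1 h

/-! ### The differences `α_k` -/

theorem sum_neg_one_pow_mul_choose_mul_pow {R : Type*} [CommRing R] (k : ℕ) (y : R) :
    ∑ j ∈ Finset.range (k + 1), (-1) ^ j * (k.choose j : R) * y ^ j = (1 - y) ^ k := by
  rw [sub_eq_add_neg, add_comm 1, add_pow]
  refine Finset.sum_congr rfl fun j _ => ?_
  rw [neg_pow, one_pow]
  ring

/-- Absorption `j C(k+1,j) = (k+1) C(k,j-1)` inside an alternating binomial sum. -/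
theorem sum_neg_one_pow_mul_choose_mul_self {R : Type*} [CommRing R] (k : ℕ) (h : ℕ → R) :
    ∑ j ∈ Finset.range (k + 1 + 1), (-1) ^ j * ((k + 1).choose j : R) * (j * h j) =
      -((k + 1) * ∑ j ∈ Finset.range (k + 1), (-1) ^ j * (k.choose j : R) * h (j + 1)) := by
  rw [Finset.sum_range_succ', Finset.mul_sum, ← Finset.sum_neg_distrib]
  simp only [Nat.cast_zero, zero_mul, mul_zero, add_zero]
  refine Finset.sum_congr rfl fun j _ => ?_
  have := congrArg (Nat.cast : ℕ → R) (Nat.add_one_mul_choose_eq k j)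
  push_cast at this ⊢
  linear_combination (-1) ^ j * h (j + 1) * this

theorem sum_neg_one_pow_mul_choose_mul_self_mul_pow {R : Type*} [CommRing R] (k : ℕ) (y : R) :
    ∑ j ∈ Finset.range (k + 1), (-1) ^ j * (k.choose j : R) * (j * y ^ j) =
      -(k * (y * (1 - y) ^ (k - 1))) := by
  cases k with
  | zero => simp
  | succ k =>
    rw [sum_neg_one_pow_mul_choose_mul_self, ← sum_neg_one_pow_mul_choose_mul_pow,
      Nat.add_sub_cancel, Finset.mul_sum, Finset.mul_sum, Finset.mul_sum]
    push_cast
    congr 1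
    exact Finset.sum_congr rfl fun j _ => by ring

theorem sum_neg_one_pow_mul_choose_mul_sq_mul_pow {R : Type*} [CommRing R] (k : ℕ) (y : R) :
    ∑ j ∈ Finset.range (k + 1), (-1) ^ j * (k.choose j : R) * (j ^ 2 * y ^ j) =
      k * (k - 1) * (y ^ 2 * (1 - y) ^ (k - 2)) - k * (y * (1 - y) ^ (k - 1)) := by
  cases k with
  | zero => simp
  | succ k =>
    have h := sum_neg_one_pow_mul_choose_mul_self k (fun j => (j : R) * y ^ j)
    have e : ∀ j : ℕ, ((j + 1 : ℕ) : R) * y ^ (j + 1) = y * (j * y ^ j) + y * y ^ j := by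
      intro j; push_cast; ring
    simp only [e, mul_add, Finset.sum_add_distrib, mul_left_comm _ y, ← Finset.mul_sum,
      sum_neg_one_pow_mul_choose_mul_self_mul_pow, sum_neg_one_pow_mul_choose_mul_pow] at h
    have e' : ∀ j : ℕ, (j : R) ^ 2 * y ^ j = j * (j * y ^ j) := fun j => by ring
    simp only [e', h, Nat.add_sub_cancel]
    rw [show k + 1 - 2 = k - 1 by omega]
    push_cast
    ring

/-- The alternating binomial sum of `(1 + jε) (jε) y^j` in closed form. The truncated exponents
`k - 1` and `k - 2` only matter where the factors `k` and `k (k - 1)` vanish. -/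
noncomputable def alphaKernel (ε : ℝ) (k : ℕ) (y : ℝ) : ℝ :=
  ε ^ 2 * (k * (k - 1) * (y ^ 2 * (1 - y) ^ (k - 2))) -
    (ε ^ 2 + ε) * (k * (y * (1 - y) ^ (k - 1)))

theorem sum_neg_one_pow_mul_choose_mul_quadratic (ε : ℝ) (k : ℕ) (y : ℝ) :
    ∑ j ∈ Finset.range (k + 1),
      (-1) ^ j * (k.choose j : ℝ) * ((1 + j * ε) * (j * ε) * y ^ j) = alphaKernel ε k y := by
  have e : ∀ j : ℕ, (-1) ^ j * (k.choose j : ℝ) * ((1 + j * ε) * (j * ε) * y ^ j) =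
      ε ^ 2 * ((-1) ^ j * (k.choose j : ℝ) * (j ^ 2 * y ^ j)) +
      ε * ((-1) ^ j * (k.choose j : ℝ) * (j * y ^ j)) := fun j => by ring
  simp only [e, Finset.sum_add_distrib, ← Finset.mul_sum, alphaKernel,
    sum_neg_one_pow_mul_choose_mul_sq_mul_pow, sum_neg_one_pow_mul_choose_mul_self_mul_pow]
  ring

/-- The `k`-th difference acts on the linear part `1 + jε` of `φ(1 + jε)`, leaving only `k = 0, 1`,
and, under the integral sign, on `(1 + jε) (jε) y^j` with `y = x^(-ε)`. -/
theorem zetaAlpha_eq {ε : ℝ} (hε : 0 < ε) (k : ℕ) :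
    zetaAlpha ε k = (((if k = 0 then 1 else 0) - (if k = 1 then ε else 0) -
      ∫ x in Ioi (1 : ℝ), Int.fract x / x ^ 2 * alphaKernel ε k (x ^ (-ε)) : ℝ) : ℂ) := by
  have hint : ∀ x ∈ Ioi (1 : ℝ), Int.fract x / x ^ 2 * alphaKernel ε k (x ^ (-ε)) =
      ∑ j ∈ Finset.range (k + 1), (-1) ^ j * (k.choose j : ℝ) * ((1 + j * ε) * (j * ε)) *
        (Int.fract x / x ^ 2 * x ^ (-(j * ε))) := by
    intro x hx
    have hx0 : (0 : ℝ) ≤ x := zero_le_one.trans (le_of_lt hx)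
    rw [← sum_neg_one_pow_mul_choose_mul_quadratic, Finset.mul_sum]
    refine Finset.sum_congr rfl fun j _ => ?_
    rw [show -(j * ε) = -ε * j by ring, Real.rpow_mul hx0, Real.rpow_natCast]
    ring
  have hlin : ∑ j ∈ Finset.range (k + 1), (-1) ^ j * (k.choose j : ℝ) * (1 + j * ε) =
      (if k = 0 then 1 else 0) - (if k = 1 then ε else 0) := by
    have e : ∀ j : ℕ, (-1) ^ j * (k.choose j : ℝ) * (1 + j * ε) =
      (-1) ^ j * (k.choose j : ℝ) * 1 ^ j + ε * ((-1) ^ j * (k.choose j : ℝ) * (j * 1 ^ j)) :=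
      fun j => by rw [one_pow]; ring
    simp only [e, Finset.sum_add_distrib, ← Finset.mul_sum, sum_neg_one_pow_mul_choose_mul_pow,
      sum_neg_one_pow_mul_choose_mul_self_mul_pow, sub_self]
    rcases k with _ | _ | k <;> simp
  rw [setIntegral_congr_fun measurableSet_Ioi hint, integral_finsetSum _ fun j _ =>
    (integrableOn_fract_mul_rpow_neg (by positivity)).const_mul _, ← hlin,
    ← Finset.sum_sub_distrib, zetaAlpha, Complex.ofReal_sum]
  refine Finset.sum_congr rfl fun j _ => ?_
  have h := zetaPhi_one_add_ofReal (t := j * ε) (by positivity)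
  push_cast at h
  rw [h, integral_const_mul]
  push_cast
  ring

/-- `y G'(1 - y)` for `G = G_{n+1}`, as a series over all `k`. -/
theorem hasSum_stirlingFirst_mul_first (n : ℕ) {y : ℝ} (hy : 0 < y) (hy1 : y < 1) :
    HasSum (fun k : ℕ => (Nat.stirlingFirst k (n + 1) : ℝ) / k.factorial *
      (k * (y * (1 - y) ^ (k - 1)))) ((-Real.log y) ^ n / n.factorial) := by
  have h := (hasSum_stirlingFirst_succ n hy hy1).mul_left y
  rw [mul_div_cancel₀ _ hy.ne'] at h
  rw [← hasSum_nat_add_iff' 1]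
  simp only [Finset.range_one, Finset.sum_singleton, Nat.cast_zero, zero_mul, mul_zero, sub_zero]
  refine h.congr_fun fun k => ?_
  rw [Nat.factorial_succ, Nat.add_sub_cancel]
  push_cast
  field_simp

/-- `y² G''(1 - y)` for `G = G_{n+1}`, as a series over all `k`. -/
theorem hasSum_stirlingFirst_mul_second (n : ℕ) {y : ℝ} (hy : 0 < y) (hy1 : y < 1) :
    HasSum (fun k : ℕ => (Nat.stirlingFirst k (n + 1) : ℝ) / k.factorial *
      (k * (k - 1) * (y ^ 2 * (1 - y) ^ (k - 2))))
      (((-Real.log y) ^ n + n * (-Real.log y) ^ (n - 1)) / n.factorial) := by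
  have h := (hasSum_stirlingFirst_add_two n hy hy1).mul_left (y ^ 2)
  rw [mul_div_cancel₀ _ (by positivity)] at h
  rw [← hasSum_nat_add_iff' 2]
  simp only [Finset.sum_range_succ, Finset.range_zero, Finset.sum_empty, Nat.cast_zero,
    Nat.cast_one, sub_self, zero_mul, mul_zero, add_zero, sub_zero]
  refine h.congr_fun fun k => ?_
  rw [Nat.factorial_succ, Nat.factorial_succ, Nat.add_sub_cancel]
  push_cast
  have : (k : ℝ) + 1 + 1 ≠ 0 := by positivity
  have : (k : ℝ) + 2 - 1 = k + 1 := by ring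
  rw [this]
  field_simp
  ring

/-! ### Termwise integration -/

/-- Interchange of the sum over `k` with the integral. Both parts of the kernel have constant sign,
so the sum of their absolute values is again `{x} / x²` times a polynomial in `log x`, which is
integrable. -/
theorem hasSum_integral_alphaKernel {ε : ℝ} (hε : 0 < ε) (n : ℕ) :
    HasSum (fun k : ℕ => (Nat.stirlingFirst k (n + 1) : ℝ) / k.factorial *
        ∫ x in Ioi (1 : ℝ), Int.fract x / x ^ 2 * alphaKernel ε k (x ^ (-ε)))
      (ε ^ (n + 1) / n.factorial * ∫ x in Ioi (1 : ℝ),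
        Int.fract x / x ^ 2 * (n * Real.log x ^ (n - 1) - Real.log x ^ n)) := by
  set P : ℕ → ℝ → ℝ := fun k y => (Nat.stirlingFirst k (n + 1) : ℝ) / k.factorial *
    (k * (y * (1 - y) ^ (k - 1))) with hP
  set Q : ℕ → ℝ → ℝ := fun k y => (Nat.stirlingFirst k (n + 1) : ℝ) / k.factorial *
    (k * (k - 1) * (y ^ 2 * (1 - y) ^ (k - 2))) with hQ
  have hy : ∀ x ∈ Ioi (1 : ℝ), 0 < x ^ (-ε) ∧ x ^ (-ε) < 1 := fun x hx =>
    ⟨Real.rpow_pos_of_pos (zero_lt_one.trans hx) _,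
      Real.rpow_lt_one_of_one_lt_of_neg hx (by linarith)⟩
  have hlog : ∀ x ∈ Ioi (1 : ℝ), -Real.log (x ^ (-ε)) = ε * Real.log x := fun x hx => by
    rw [Real.log_rpow (zero_lt_one.trans hx)]; ring
  have hPs : ∀ x ∈ Ioi (1 : ℝ), HasSum (fun k => P k (x ^ (-ε)))
      ((ε * Real.log x) ^ n / n.factorial) := fun x hx => by
    rw [← hlog x hx]; exact hasSum_stirlingFirst_mul_first n (hy x hx).1 (hy x hx).2
  have hQs : ∀ x ∈ Ioi (1 : ℝ), HasSum (fun k => Q k (x ^ (-ε)))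
      (((ε * Real.log x) ^ n + n * (ε * Real.log x) ^ (n - 1)) / n.factorial) := fun x hx => by
    rw [← hlog x hx]; exact hasSum_stirlingFirst_mul_second n (hy x hx).1 (hy x hx).2
  have hbd : ∀ x ∈ Ioi (1 : ℝ), HasSum
      (fun k => Int.fract x / x ^ 2 * (ε ^ 2 * Q k (x ^ (-ε)) + (ε ^ 2 + ε) * P k (x ^ (-ε))))
      (Int.fract x / x ^ 2 *
        (ε ^ 2 * (((ε * Real.log x) ^ n + n * (ε * Real.log x) ^ (n - 1)) / n.factorial) +
          (ε ^ 2 + ε) * ((ε * Real.log x) ^ n / n.factorial))) := fun x hx =>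
    (((hQs x hx).mul_left _).add ((hPs x hx).mul_left _)).mul_left _
  have hres : ∀ x ∈ Ioi (1 : ℝ), HasSum
      (fun k => (Nat.stirlingFirst k (n + 1) : ℝ) / k.factorial *
        (Int.fract x / x ^ 2 * alphaKernel ε k (x ^ (-ε))))
      (ε ^ (n + 1) / n.factorial *
        (Int.fract x / x ^ 2 * (n * Real.log x ^ (n - 1) - Real.log x ^ n))) := fun x hx => by
    have h := (((hQs x hx).mul_left (ε ^ 2)).sub ((hPs x hx).mul_left (ε ^ 2 + ε))).mul_left
      (Int.fract x / x ^ 2)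
    -- The two `(log x) ^ n` contributions of order `ε ^ (n + 2)` cancel.
    have hval : ε ^ (n + 1) / n.factorial *
        (Int.fract x / x ^ 2 * (n * Real.log x ^ (n - 1) - Real.log x ^ n)) =
        Int.fract x / x ^ 2 *
        (ε ^ 2 * (((ε * Real.log x) ^ n + n * (ε * Real.log x) ^ (n - 1)) / n.factorial) -
          (ε ^ 2 + ε) * ((ε * Real.log x) ^ n / n.factorial)) := by
      rcases n with _ | n
      · simp
        ring
      · rw [Nat.add_sub_cancel]
        ring
    rw [hval]
    refine h.congr_fun fun k => ?_
    simp only [hP, hQ, alphaKernel]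
    ring
  simp only [← integral_const_mul]
  refine hasSum_integral_of_dominated_convergence (fun k x => Int.fract x / x ^ 2 *
    (ε ^ 2 * Q k (x ^ (-ε)) + (ε ^ 2 + ε) * P k (x ^ (-ε)))) (fun k => ?_) (fun k => ?_) ?_ ?_ ?_
  · have := measurable_fract (R := ℝ)
    unfold alphaKernel
    exact Measurable.aestronglyMeasurable (by fun_prop)
  · refine (ae_restrict_iff' measurableSet_Ioi).2 (ae_of_all _ fun x hx => ?_)
    obtain ⟨h0, h1⟩ := hy x hx
    have hw0 : 0 ≤ Int.fract x / x ^ 2 := div_nonneg (Int.fract_nonneg x) (by positivity)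
    have hy0 : 0 ≤ 1 - x ^ (-ε) := by linarith
    have hk : 0 ≤ (k : ℝ) * (k - 1) := by
      rcases k with _ | k
      · simp
      · push_cast; rw [add_sub_cancel_right]; positivity
    have hP0 : 0 ≤ P k (x ^ (-ε)) := by positivity
    have hQ0 : 0 ≤ Q k (x ^ (-ε)) := by positivity
    have e : (Nat.stirlingFirst k (n + 1) : ℝ) / k.factorial *
        (Int.fract x / x ^ 2 * alphaKernel ε k (x ^ (-ε))) = Int.fract x / x ^ 2 *
        (ε ^ 2 * Q k (x ^ (-ε)) - (ε ^ 2 + ε) * P k (x ^ (-ε))) := by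
      simp only [hP, hQ, alphaKernel]; ring
    rw [e, norm_mul, Real.norm_of_nonneg hw0]
    refine mul_le_mul_of_nonneg_left ((norm_sub_le _ _).trans ?_) hw0
    rw [Real.norm_of_nonneg (by positivity), Real.norm_of_nonneg (by positivity)]
  · exact (ae_restrict_iff' measurableSet_Ioi).2 (ae_of_all _ fun x hx => (hbd x hx).summable)
  · have hi : IntegrableOn (fun x : ℝ =>
        (2 * ε ^ 2 + ε) * ε ^ n / n.factorial * (Int.fract x / x ^ 2 * Real.log x ^ n) +
        ε ^ 2 * n * ε ^ (n - 1) / n.factorial * (Int.fract x / x ^ 2 * Real.log x ^ (n - 1)))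
        (Ioi 1) :=
      ((integrableOn_fract_mul_log_pow n).const_mul _).add
        ((integrableOn_fract_mul_log_pow (n - 1)).const_mul _)
    refine hi.congr_fun (fun x hx => ?_) measurableSet_Ioi
    simp only [(hbd x hx).tsum_eq, mul_pow]
    ring
  · exact (ae_restrict_iff' measurableSet_Ioi).2 (ae_of_all _ hres)

theorem stieltjesConst_eq (n : ℕ) : stieltjesConst n = (if n = 0 then 1 else 0) +
    ∫ x in Ioi (1 : ℝ), Int.fract x / x ^ 2 * (n * Real.log x ^ (n - 1) - Real.log x ^ n) :=
  (tendsto_stieltjesSeq n).limUnder_eq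

/-- The series over all `k`. The signs `(-1)^k` and `(-1)^(k+n+1)` combine to the constant
`(-1)^(n+1)`, which leaves unsigned Stirling numbers. -/
theorem hasSum_zetaAlpha_mul_stirling {ε : ℝ} (hε : 0 < ε) (n : ℕ) :
    HasSum (fun k : ℕ => (-1 : ℂ) ^ k / (k.factorial : ℂ) * zetaAlpha ε k *
        (signedStirlingFirst k (n + 1) : ℂ))
      ((-1 : ℂ) ^ n * (ε : ℂ) ^ (n + 1) / n.factorial * stieltjesConst n) := by
  have hlin : HasSum (fun k : ℕ => (Nat.stirlingFirst k (n + 1) : ℝ) / k.factorial *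
      ((if k = 0 then 1 else 0) - (if k = 1 then ε else 0)))
      (-(ε ^ (n + 1) / n.factorial * if n = 0 then 1 else 0)) := by
    have h := hasSum_single (f := fun k : ℕ => (Nat.stirlingFirst k (n + 1) : ℝ) / k.factorial *
      ((if k = 0 then 1 else 0) - (if k = 1 then ε else 0))) 1 (fun k hk => by
        rcases k with _ | _ | k <;> simp at hk ⊢)
    convert h using 1
    rcases n with _ | n <;> simp [Nat.stirlingFirst_self, Nat.stirlingFirst_eq_zero_of_lt]
  have h := Complex.hasSum_ofReal.2
    ((hlin.sub (hasSum_integral_alphaKernel hε n)).mul_left ((-1) ^ (n + 1)))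
  convert h using 1
  · ext k
    have e : ((-1 : ℂ) ^ k) * (-1) ^ k = 1 := by rw [← mul_pow]; simp
    rw [zetaAlpha_eq hε, signedStirlingFirst]
    push_cast
    rw [pow_add]
    linear_combination ((-1) ^ (n + 1) * (Nat.stirlingFirst k (n + 1) : ℂ) / k.factorial *
      (((if k = 0 then 1 else 0 : ℝ) : ℂ) - ((if k = 1 then ε else 0 : ℝ) : ℂ) -
      ((∫ x in Ioi (1 : ℝ), Int.fract x / x ^ 2 * alphaKernel ε k (x ^ (-ε)) : ℝ) : ℂ))) * e
  · rw [stieltjesConst_eq]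
    push_cast
    ring

theorem mainTheorem1 (ε : ℝ) (hε : 0 < ε) (n : ℕ) :
    Tendsto (stieltjesSeq n) atTop (𝓝 (stieltjesConst n)) ∧
    Summable (fun m : ℕ =>
      (-1 : ℂ) ^ (n + 1 + m) / ((n + 1 + m).factorial : ℂ) *
        zetaAlpha ε (n + 1 + m) * (signedStirlingFirst (n + 1 + m) (n + 1) : ℂ)) ∧
    (stieltjesConst n : ℂ) =
      (-1 : ℂ) ^ n * (n.factorial : ℂ) / (ε : ℂ) ^ (n + 1) *
        ∑' m : ℕ,
          (-1 : ℂ) ^ (n + 1 + m) / ((n + 1 + m).factorial : ℂ) *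
            zetaAlpha ε (n + 1 + m) * (signedStirlingFirst (n + 1 + m) (n + 1) : ℂ) := by
  have hs : HasSum (fun m : ℕ =>
      (-1 : ℂ) ^ (n + 1 + m) / ((n + 1 + m).factorial : ℂ) *
        zetaAlpha ε (n + 1 + m) * (signedStirlingFirst (n + 1 + m) (n + 1) : ℂ))
      ((-1 : ℂ) ^ n * (ε : ℂ) ^ (n + 1) / n.factorial * stieltjesConst n) := by
    -- The terms with `k < n + 1` vanish, since `S(k, n + 1) = 0`.
    refine ((add_right_injective (n + 1)).hasSum_iff fun k hk => ?_).2
      (hasSum_zetaAlpha_mul_stirling hε n)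
    have hlt : k < n + 1 := by
      by_contra! hle
      exact hk ⟨k - (n + 1), by simp only; omega⟩
    simp [signedStirlingFirst, Nat.stirlingFirst_eq_zero_of_lt hlt]
  refine ⟨?_, hs.summable, ?_⟩
  · rw [stieltjesConst_eq]
    exact tendsto_stieltjesSeq n
  · rw [hs.tsum_eq]
    have h1 : (ε : ℂ) ≠ 0 := by exact_mod_cast hε.ne'
    have h2 : (n.factorial : ℂ) ≠ 0 := by exact_mod_cast n.factorial_ne_zero
    have e : ((-1 : ℂ) ^ n) * (-1) ^ n = 1 := by rw [← mul_pow]; simp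
    field_simp
    linear_combination -(stieltjesConst n : ℂ) * e
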